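/- Let $A$ be a (complex, not necessarily unital) C*-algebra, and let $T : A \to A$ be an elementary operator, that is, a map of the form $T(x) = \sum_{i=1}^N a_i x b_i$ with $a_i, b_i \in A$. Let $I$ be a two-sided (not necessarily closed) ideal of $A$. Then $\overline{T(I)}$ is a proximinal subspace of the Banach space $\overline{T(A)}$: for every $x \in \overline{T(A)}$ there is $y \in \overline{T(I)}$ with $\|x - y\| = \inf_{y' \in \overline{T(I)}} \|x - y'\|$. Equivalently, every element $z$ of the quotient space $\overline{T(A)}/\overline{T(I)}$ has a representative $x \in \overline{T(A)}$ with $\|x\| = \|z\|$, where $\|z\|$ is the quotient norm. -/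

import Mathlib

/-- An elementary operator on a (not necessarily unital) complex algebra `A`: a map of the form
`x ↦ ∑ i, a i * x * b i` with finitely many coefficients `a i`, `b i` taken from `A` itself. -/
def IsElementaryOperator {A : Type*} [NonUnitalRing A] [Module ℂ A] (T : A →ₗ[ℂ] A) : Prop :=
  ∃ (N : ℕ) (a b : Fin N → A), ∀ x : A, T x = ∑ i, a i * x * b i

/-- A (two-sided, not necessarily closed) ideal of a complex algebra: a linear subspace which
absorbs multiplication by elements of the algebra on both sides. -/
def IsAlgebraIdeal {A : Type*} [NonUnitalRing A] [Module ℂ A] (I : Submodule ℂ A) : Prop :=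
  ∀ a : A, ∀ x ∈ I, a * x ∈ I ∧ x * a ∈ I

/-- A subspace `Y` of a normed space `X` is proximinal if the distance from each point of `X`
to `Y` is attained. -/
def IsProximinal {X : Type*} [NormedAddCommGroup X] [NormedSpace ℂ X] (Y : Submodule ℂ X) : Prop :=
  ∀ x : X, ∃ y ∈ Y, ‖x - y‖ = Metric.infDist x (Y : Set X)

/-! Work in the unitization, where `I` is still an ideal and has a quasicentral approximate unit of
positive contractions `e`. For an elementary operator, `e * T x - T (e * x) = ∑ (e * a i - a i * e)
* x * b i` tends to zero. So for `w` in the closure of the range, `e * w` is almost in `T(I)`, and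
small multiples of it serve as corrections.

Let `d` be the distance of `w` to the closure `F` of `T(I)`, with `‖w‖ ≤ d + ε`, and let `y₀ ∈ F`
almost attain it. With `s = √e`, `r = √(1 - e)`, both almost commuting with `w` and `y₀`, and `(1 -
e) * y₀` small, `w - t e w ≈ s ((1 - t) w) s + r (w - y₀) r`. The right side has norm at most the
larger of `‖(1 - t) w‖` and `‖w - y₀‖`. Taking `t = ε / (d + ε)` halves the excess over `d` at a
cost of order `ε`; iterating gives a Cauchy sequence whose limit attains the distance
(`exists_mem_norm_sub_le_half`, `exists_norm_sub_eq_infDist`). -/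

section CStarEstimates

/-! ### Norm estimates and approximate units of non-closed ideals. -/

variable {B : Type*} [CStarAlgebra B] [PartialOrder B] [StarOrderedRing B]

/-- The product of a contractive row of commuting selfadjoint elements with a column. -/
theorem norm_mul_add_mul_sq_le {s r : B} (hs : IsSelfAdjoint s) (hr : IsSelfAdjoint r)
    (hsr : Commute s r) (h : s * s + r * r ≤ 1) (α β : B) :
    ‖s * α + r * β‖ ^ 2 ≤ ‖α‖ ^ 2 + ‖β‖ ^ 2 := by
  -- The second summand comes from the other row of the matrix `[s, r; r, -s]`; adding it cancels
  -- the cross terms.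
  have key : star (s * α + r * β) * (s * α + r * β) + star (r * α - s * β) * (r * α - s * β)
      = star α * (s * s + r * r) * α + star β * (s * s + r * r) * β := by
    simp only [star_add, star_sub, star_mul, hs.star_eq, hr.star_eq]
    have e1 : star α * s * (r * β) = star α * r * (s * β) := by
      rw [mul_assoc, ← mul_assoc s, hsr.eq]; noncomm_ring
    have e2 : star β * r * (s * α) = star β * s * (r * α) := by
      rw [mul_assoc, ← mul_assoc r, ← hsr.eq]; noncomm_ring
    simp only [add_mul, mul_add, sub_mul, mul_sub, e1, e2]
    noncomm_ring
  have h1 : star (s * α + r * β) * (s * α + r * β) ≤ star α * α + star β * β := by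
    calc _ ≤ _ := le_add_of_nonneg_right (star_mul_self_nonneg (r * α - s * β))
      _ = _ := key
      _ ≤ star α * 1 * α + star β * 1 * β :=
        add_le_add (star_left_conjugate_le_conjugate h α) (star_left_conjugate_le_conjugate h β)
      _ = _ := by simp
  calc ‖s * α + r * β‖ ^ 2 = ‖star (s * α + r * β) * (s * α + r * β)‖ := by
        rw [CStarRing.norm_star_mul_self, sq]
    _ ≤ ‖star α * α + star β * β‖ :=
        CStarAlgebra.norm_le_norm_of_nonneg_of_le (star_mul_self_nonneg _) h1
    _ ≤ ‖star α * α‖ + ‖star β * β‖ := norm_add_le _ _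
    _ = _ := by simp only [CStarRing.norm_star_mul_self, sq]

theorem norm_mul_add_mul_sq_le' {s r : B} (hs : IsSelfAdjoint s) (hr : IsSelfAdjoint r)
    (hsr : Commute s r) (h : s * s + r * r ≤ 1) (α β : B) :
    ‖α * s + β * r‖ ^ 2 ≤ ‖α‖ ^ 2 + ‖β‖ ^ 2 := by
  have := norm_mul_add_mul_sq_le hs hr hsr h (star α) (star β)
  rw [← norm_star] at this
  simpa [hs.star_eq, hr.star_eq] using this

/-- The element is the first entry of `U · diag(a, b) · (s, r)ᵀ`, where `U = [s, r; r, -s]` is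
unitary and the column is isometric. -/
theorem norm_conjugate_add_conjugate_le {s r : B} (hs : IsSelfAdjoint s) (hr : IsSelfAdjoint r)
    (hsr : Commute s r) (h : s * s + r * r = 1) {a b : B} {M : ℝ} (hM : 0 ≤ M)
    (ha : ‖a‖ ≤ M) (hb : ‖b‖ ≤ M) : ‖s * a * s + r * b * r‖ ≤ M := by
  have key : star (s * a * s + r * b * r) * (s * a * s + r * b * r)
      + star (r * a * s - s * b * r) * (r * a * s - s * b * r)
      = star s * (star a * (s * s + r * r) * a) * s
        + star r * (star b * (s * s + r * r) * b) * r := by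
    simp only [star_add, star_sub, star_mul, hs.star_eq, hr.star_eq]
    have e1 : s * (star a * s) * (r * b * r) = s * (star a * r) * (s * b * r) := by
      have := congrArg (fun z => s * star a * z * (b * r)) hsr.eq
      simpa only [mul_assoc] using this
    have e2 : r * (star b * r) * (s * a * s) = r * (star b * s) * (r * a * s) := by
      have := congrArg (fun z => r * star b * z * (a * s)) hsr.eq.symm
      simpa only [mul_assoc] using this
    simp only [add_mul, mul_add, sub_mul, mul_sub, e1, e2]
    noncomm_ring
  have hle {x : B} (hx : ‖x‖ ≤ M) : star x * 1 * x ≤ algebraMap ℝ B (M ^ 2) := by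
    rw [mul_one]
    refine CStarAlgebra.star_mul_le_algebraMap_norm_sq.trans (algebraMap_mono B ?_)
    gcongr
  have h1 : star (s * a * s + r * b * r) * (s * a * s + r * b * r)
      ≤ algebraMap ℝ B (M ^ 2) := by
    calc _ ≤ _ := le_add_of_nonneg_right (star_mul_self_nonneg (r * a * s - s * b * r))
      _ = _ := key
      _ ≤ star s * algebraMap ℝ B (M ^ 2) * s + star r * algebraMap ℝ B (M ^ 2) * r := by
        rw [h]
        exact add_le_add (star_left_conjugate_le_conjugate (hle ha) s)
          (star_left_conjugate_le_conjugate (hle hb) r)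
      _ = algebraMap ℝ B (M ^ 2) * (s * s + r * r) := by
        rw [hs.star_eq, hr.star_eq, ← Algebra.commutes (M ^ 2) s, ← Algebra.commutes (M ^ 2) r]
        noncomm_ring
      _ = _ := by rw [h, mul_one]
  have h2 := CStarAlgebra.norm_le_iff_le_algebraMap _ (sq_nonneg M) (star_mul_self_nonneg _) |>.2 h1
  rw [CStarRing.norm_star_mul_self, ← sq] at h2
  exact le_of_abs_le (abs_le_of_sq_le_sq h2 hM)

/-- For positive `c`, the element `c * (δ + c)⁻¹` is a positive contraction and
acts as an approximate unit on anything dominated by `c`. -/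
theorem exists_contraction_of_nonneg {c : B} (hc : 0 ≤ c) {δ : ℝ} (hδ : 0 < δ) :
    ∃ k : B, 0 ≤ c * k ∧ c * k ≤ 1 ∧
      (1 - c * k) * c * (1 - c * k) ≤ algebraMap ℝ B δ := by
  have hsa : IsSelfAdjoint c := .of_nonneg hc
  have hsp : ∀ x ∈ spectrum ℝ c, 0 ≤ x := fun x hx => spectrum_nonneg_of_nonneg hc hx
  have hcont : ContinuousOn (fun x : ℝ => (δ + x)⁻¹) (spectrum ℝ c) :=
    ContinuousOn.inv₀ (by fun_prop) fun x hx => by have := hsp x hx; positivity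
  have hcont' : ContinuousOn (fun x : ℝ => x * (δ + x)⁻¹) (spectrum ℝ c) := by fun_prop
  have hmul : c * cfc (fun x : ℝ => (δ + x)⁻¹) c = cfc (fun x : ℝ => x * (δ + x)⁻¹) c := by
    rw [cfc_mul (fun x : ℝ => x) _ c, cfc_id' ℝ c hsa]
  have hsub : 1 - c * cfc (fun x : ℝ => (δ + x)⁻¹) c
      = cfc (fun x : ℝ => 1 - x * (δ + x)⁻¹) c := by
    rw [hmul, cfc_sub (fun _ => (1 : ℝ)) _ c, cfc_const_one ℝ c hsa]
  refine ⟨cfc (fun x : ℝ => (δ + x)⁻¹) c, ?_, ?_, ?_⟩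
  · rw [hmul]
    exact cfc_nonneg fun x hx => by have := hsp x hx; positivity
  · rw [hmul]
    refine cfc_le_one _ _ fun x hx => ?_
    have := hsp x hx
    rw [← div_eq_mul_inv, div_le_one (by positivity)]
    linarith
  · rw [hsub]
    nth_rw 2 [← cfc_id' ℝ c hsa]
    rw [← cfc_mul _ _ c, ← cfc_mul _ _ c]
    refine cfc_le_algebraMap _ _ _ fun x hx => ?_
    have := hsp x hx
    have h0 : 0 < δ + x := by positivity
    have : (1 - x * (δ + x)⁻¹) * x * (1 - x * (δ + x)⁻¹) = δ * (δ * x / (δ + x) ^ 2) := by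
      field_simp; ring
    rw [this]
    refine mul_le_of_le_one_right hδ.le ?_
    rw [div_le_one (by positivity)]
    nlinarith

theorem norm_sq_le_of_conjugate_le {g c y : B} (hg : IsSelfAdjoint g) {δ : ℝ} (hδ : 0 ≤ δ)
    (h : g * c * g ≤ algebraMap ℝ B δ) (hy : star y * y ≤ c) : ‖y * g‖ ^ 2 ≤ δ := by
  rw [sq, ← CStarRing.norm_star_mul_self,
    CStarAlgebra.norm_le_iff_le_algebraMap _ hδ (star_mul_self_nonneg _)]
  refine le_trans ?_ h
  have := star_left_conjugate_le_conjugate hy g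
  rw [hg.star_eq] at this
  simpa [hg.star_eq, mul_assoc] using this

/-- The positive contractions in an ideal, which need not be closed. -/
def idealContractions (J : Submodule ℂ B) : Set B := {e | e ∈ J ∧ 0 ≤ e ∧ e ≤ 1}

theorem exists_approximateUnit_of_finset {J : Submodule ℂ B} (hJ : IsAlgebraIdeal J)
    (t : Finset J) {ε : ℝ} (hε : 0 < ε) :
    ∃ e ∈ idealContractions J, ∀ y ∈ t, ‖(y : B) * e - y‖ < ε ∧ ‖e * (y : B) - y‖ < ε := by
  -- This `c` lies in the ideal and dominates each `star y * y` and `y * star y`, so one contraction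
  -- `c * k` serves on both sides.
  set c : B := ∑ y ∈ t, (star (y : B) * y + y * star (y : B)) with hc
  have hcJ : c ∈ J := J.sum_mem fun y _ =>
    J.add_mem (hJ _ _ y.2).1 (hJ _ _ y.2).2
  have hpos : ∀ y : J, 0 ≤ star (y : B) * y + y * star (y : B) := fun y =>
    add_nonneg (star_mul_self_nonneg _) (mul_star_self_nonneg _)
  have hc0 : 0 ≤ c := Finset.sum_nonneg fun y _ => hpos y
  obtain ⟨k, hk0, hk1, hk⟩ := exists_contraction_of_nonneg hc0 (δ := (ε / 2) ^ 2) (by positivity)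
  refine ⟨c * k, ⟨(hJ _ _ hcJ).2, hk0, hk1⟩, fun y hy => ?_⟩
  have hle : star (y : B) * y + y * star (y : B) ≤ c :=
    Finset.single_le_sum (f := fun y : J => star (y : B) * y + y * star (y : B))
      (fun y _ => hpos y) hy
  have hg : IsSelfAdjoint (1 - c * k) := (IsSelfAdjoint.one B).sub (.of_nonneg hk0)
  have h1 := norm_sq_le_of_conjugate_le (y := (y : B)) hg (by positivity) hk
    ((le_add_of_nonneg_right (mul_star_self_nonneg _)).trans hle)
  have h2 := norm_sq_le_of_conjugate_le (y := star (y : B)) hg (by positivity) hk (by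
    rw [star_star]
    exact (le_add_of_nonneg_left (star_mul_self_nonneg _)).trans hle)
  have e2 : ‖star (y : B) * (1 - c * k)‖ = ‖(1 - c * k) * y‖ := by
    rw [← norm_star]; simp [(IsSelfAdjoint.of_nonneg hk0).star_eq, -star_mul, star_mul (star (y : B))]
  rw [e2] at h2
  have h1' := le_of_abs_le (abs_le_of_sq_le_sq h1 (by positivity))
  have h2' := le_of_abs_le (abs_le_of_sq_le_sq h2 (by positivity))
  rw [mul_sub, mul_one, norm_sub_rev] at h1'
  rw [sub_mul, one_mul, norm_sub_rev] at h2'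
  exact ⟨by linarith, by linarith⟩

end CStarEstimates

/-- Turns approximation on finite sets into convergence along one filter, the image of `atTop` on
pairs (finite set, precision). -/
theorem exists_filter_of_finset {X ι : Type*} (K : Set X) (ψ : ι → X → ℝ)
    (h : ∀ (t : Finset ι) (ε : ℝ), 0 < ε → ∃ x ∈ K, ∀ i ∈ t, ψ i x < ε) :
    ∃ l : Filter X, l.NeBot ∧ (∀ᶠ x in l, x ∈ K) ∧ ∀ i, ∀ ε > 0, ∀ᶠ x in l, ψ i x < ε := by
  classical
  choose f hfK hf using fun p : Finset ι × ℕ =>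
    h p.1 (1 / ((p.2 : ℝ) + 1)) Nat.one_div_pos_of_nat
  refine ⟨Filter.map f Filter.atTop, inferInstance,
    Filter.eventually_map.2 (.of_forall hfK), fun i ε hε => Filter.eventually_map.2 ?_⟩
  obtain ⟨n, hn⟩ := exists_nat_one_div_lt hε
  filter_upwards [Filter.eventually_ge_atTop (({i}, n) : Finset ι × ℕ)] with p hp
  refine (hf p i (hp.1 (by simp))).trans (lt_of_le_of_lt ?_ hn)
  exact Nat.one_div_le_one_div hp.2

open Filter Topology

/-! ### Quasicentral approximate units. -/

section Quasicentral

variable {B : Type*} [CStarAlgebra B] [PartialOrder B] [StarOrderedRing B]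

theorem tendsto_iff_eventually_norm_sub_lt {X E : Type*} [SeminormedAddCommGroup E]
    {l : Filter X} {f : X → E} {y : E} :
    Tendsto f l (𝓝 y) ↔ ∀ ε > 0, ∀ᶠ x in l, ‖f x - y‖ < ε := by
  simp only [Metric.tendsto_nhds, dist_eq_norm]

theorem exists_approximateUnit {J : Submodule ℂ B} (hJ : IsAlgebraIdeal J) :
    ∃ l : Filter B, l.NeBot ∧ (∀ᶠ e in l, e ∈ idealContractions J) ∧
      (∀ y ∈ J, Tendsto (fun e => y * e) l (𝓝 y)) ∧
      ∀ y ∈ J, Tendsto (fun e => e * y) l (𝓝 y) := by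
  obtain ⟨l, hl, hK, h⟩ := exists_filter_of_finset (idealContractions J)
    (fun (y : J) e => max ‖(y : B) * e - y‖ ‖e * (y : B) - y‖) fun t ε hε => by
      simpa only [max_lt_iff] using exists_approximateUnit_of_finset hJ t hε
  refine ⟨l, hl, hK, fun y hy => ?_, fun y hy => ?_⟩ <;>
    rw [tendsto_iff_eventually_norm_sub_lt] <;> intro ε hε <;>
    filter_upwards [h ⟨y, hy⟩ ε hε] with e he
  · exact (max_lt_iff.1 he).1
  · exact (max_lt_iff.1 he).2

theorem norm_le_one_of_mem_idealContractions {J : Submodule ℂ B} {e : B}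
    (he : e ∈ idealContractions J) : ‖e‖ ≤ 1 :=
  (CStarAlgebra.norm_le_one_iff_of_nonneg e he.2.1).2 he.2.2

theorem convex_idealContractions (J : Submodule ℂ B) : Convex ℝ (idealContractions J) := by
  intro x hx y hy a b ha hb hab
  refine ⟨J.add_mem (J.smul_of_tower_mem a hx.1) (J.smul_of_tower_mem b hy.1),
    add_nonneg (smul_nonneg ha hx.2.1) (smul_nonneg hb hy.2.1), ?_⟩
  calc a • x + b • y ≤ a • (1 : B) + b • (1 : B) :=
        add_le_add (smul_le_smul_of_nonneg_left hx.2.2 ha)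
          (smul_le_smul_of_nonneg_left hy.2.2 hb)
    _ = 1 := by rw [← add_smul, hab, one_smul]

/-- The defect is `2 e (1 - e)`, written as a sum of conjugates of positive elements. -/
theorem mul_self_add_one_sub_mul_self_le_one {e : B} (he0 : 0 ≤ e) (he1 : e ≤ 1) :
    e * e + (1 - e) * (1 - e) ≤ 1 := by
  have hs : IsSelfAdjoint e := .of_nonneg he0
  have hs' : IsSelfAdjoint (1 - e) := (IsSelfAdjoint.one B).sub hs
  have h1 : 0 ≤ e * (1 - e) * e := by
    simpa [hs.star_eq] using star_left_conjugate_nonneg (sub_nonneg.2 he1) e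
  have h2 : 0 ≤ (1 - e) * e * (1 - e) := by
    simpa only [hs'.star_eq] using star_left_conjugate_nonneg he0 (1 - e)
  rw [← sub_nonneg]
  have : 1 - (e * e + (1 - e) * (1 - e))
      = (e * (1 - e) * e + (1 - e) * e * (1 - e)) + (e * (1 - e) * e + (1 - e) * e * (1 - e)) := by
    noncomm_ring
  rw [this]
  positivity

/-- A bounded functional restricted to an ideal is uniformly concentrated on an approximate
unit of this ideal. -/
theorem eventually_abs_apply_mul_one_sub_le {J : Submodule ℂ B} (hJ : IsAlgebraIdeal J)
    {l : Filter B} (hK : ∀ᶠ e in l, e ∈ idealContractions J)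
    (hl : ∀ y ∈ J, Tendsto (fun e => y * e) l (𝓝 y)) (f : B →L[ℝ] ℝ) {ε : ℝ} (hε : 0 < ε) :
    ∀ᶠ e in l, ∀ y ∈ J, |f (y * (1 - e))| ≤ ε * ‖y‖ := by
  set S : Set ℝ := f '' {x | x ∈ J ∧ ‖x‖ ≤ 1} with hS
  have hbdd : BddAbove S := by
    refine ⟨‖f‖, ?_⟩
    rintro _ ⟨x, ⟨-, hx⟩, rfl⟩
    exact (le_abs_self _).trans ((f.le_opNorm x).trans (mul_le_of_le_one_right (norm_nonneg _) hx))
  have h0S : (0 : ℝ) ∈ S := ⟨0, ⟨J.zero_mem, by simp⟩, map_zero f⟩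
  set m := sSup S with hm
  have hm0 : 0 ≤ m := le_csSup hbdd h0S
  have hfm : ∀ z ∈ J, f z ≤ m * ‖z‖ := by
    intro z hz
    rcases eq_or_ne z 0 with rfl | hz0
    · simp
    have hpos : 0 < ‖z‖ := norm_pos_iff.2 hz0
    have : f (‖z‖⁻¹ • z) ≤ m := le_csSup hbdd ⟨_, ⟨J.smul_of_tower_mem _ hz, by
      rw [norm_smul, norm_inv, norm_norm, inv_mul_cancel₀ hpos.ne']⟩, rfl⟩
    rw [map_smul, smul_eq_mul, inv_mul_le_iff₀ hpos] at this
    linarith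
  set t := ε / (m + 1) with ht
  have ht0 : 0 < t := by positivity
  have hmt : m * t ≤ ε := by
    rw [ht, mul_div_assoc', div_le_iff₀ (by positivity)]
    nlinarith
  -- `x` almost attains the norm `m` of `f` on `J`, and `x * e` still does. Adding `t • y * (1 - e)`
  -- raises the norm bound only to `1 + t ^ 2 / 2`, so `f (y * (1 - e))` must be small.
  obtain ⟨_, ⟨x, ⟨hxJ, hx1⟩, rfl⟩, hx⟩ :=
    exists_lt_of_lt_csSup ⟨0, h0S⟩ (show m - t * ε / 2 < sSup S by
      rw [← hm]; linarith [mul_pos ht0 hε])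
  have hev : ∀ᶠ e in l, m - t * ε / 2 < f (x * e) :=
    ((f.continuous.tendsto x).comp (hl x hxJ)).eventually_const_lt hx
  filter_upwards [hK, hev] with e he hxe
  have hsa : IsSelfAdjoint e := .of_nonneg he.2.1
  have hunit : ∀ y ∈ J, ‖y‖ ≤ 1 → f (y * (1 - e)) ≤ ε := by
    intro y hy hy1
    have hn := norm_mul_add_mul_sq_le' hsa ((IsSelfAdjoint.one B).sub hsa)
      ((Commute.one_right e).sub_right (Commute.refl e))
      (mul_self_add_one_sub_mul_self_le_one he.2.1 he.2.2) x (t • y)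
    have hty : ‖t • y‖ ≤ t := by
      rw [norm_smul, Real.norm_of_nonneg ht0.le]
      exact mul_le_of_le_one_right ht0.le hy1
    have hn' : ‖x * e + (t • y) * (1 - e)‖ ≤ 1 + t ^ 2 / 2 := by
      refine le_of_abs_le (abs_le_of_sq_le_sq (hn.trans ?_) (by positivity))
      nlinarith [norm_nonneg x, norm_nonneg (t • y), sq_nonneg (t ^ 2)]
    have hmem : x * e + (t • y) * (1 - e) ∈ J := by
      refine J.add_mem (hJ _ _ hxJ).2 (hJ _ _ (J.smul_of_tower_mem t hy)).2
    have h3 := (hfm _ hmem).trans (mul_le_mul_of_nonneg_left hn' hm0)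
    rw [map_add, smul_mul_assoc, map_smul, smul_eq_mul] at h3
    have h4 : t * f (y * (1 - e)) ≤ t * ε := by nlinarith
    exact le_of_mul_le_mul_left h4 ht0
  have hle : ∀ y ∈ J, f (y * (1 - e)) ≤ ε * ‖y‖ := by
    intro y hy
    rcases eq_or_ne y 0 with rfl | hy0
    · simp
    have hpos : 0 < ‖y‖ := norm_pos_iff.2 hy0
    have := hunit (‖y‖⁻¹ • y) (J.smul_of_tower_mem _ hy) (by
      rw [norm_smul, norm_inv, norm_norm, inv_mul_cancel₀ hpos.ne'])
    rw [smul_mul_assoc, map_smul, smul_eq_mul, inv_mul_le_iff₀ hpos] at this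
    linarith
  intro y hy
  refine abs_le.2 ⟨?_, hle y hy⟩
  have := hle (-y) (J.neg_mem hy)
  rw [neg_mul, map_neg, norm_neg] at this
  linarith

/-- Commutators with an approximate unit of an ideal tend weakly to zero. -/
theorem tendsto_apply_commutator {J : Submodule ℂ B} (hJ : IsAlgebraIdeal J)
    {l : Filter B} [l.NeBot] (hK : ∀ᶠ e in l, e ∈ idealContractions J)
    (hl : ∀ y ∈ J, Tendsto (fun e => y * e) l (𝓝 y))
    (hl' : ∀ y ∈ J, Tendsto (fun e => e * y) l (𝓝 y)) (f : B →L[ℝ] ℝ) (a : B) :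
    Tendsto (fun e => f (e * a - a * e)) l (𝓝 0) := by
  rw [tendsto_iff_eventually_norm_sub_lt]
  intro ε hε
  set η := ε / (4 * (‖a‖ + 1)) with hη
  have hη0 : 0 < η := by positivity
  have hηε : 4 * (η * ‖a‖ + η) = ε := by rw [hη]; field_simp
  have hP := eventually_abs_apply_mul_one_sub_le hJ hK hl f hη0
  have hnear : ∀ {u : B}, u ∈ idealContractions J → ∀ᶠ e in l, |f (e * (a * u) - a * u)| < η := by
    intro u hu
    have h1 := hl' (a * u) (hJ a u hu.1).1
    have h2 := (f.continuous.tendsto _).comp h1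
    filter_upwards [tendsto_iff_eventually_norm_sub_lt.1 h2 η hη0] with e he
    rwa [map_sub]
  have hclose : ∀ {u e : B}, (∀ y ∈ J, |f (y * (1 - u))| ≤ η * ‖y‖) → e ∈ idealContractions J →
      |f (e * (a * u) - a * u)| < η → |f (e * a) - f (a * u)| < η * ‖a‖ + η := by
    intro u e hu he hue
    have h1 := hu (e * a) (hJ a e he.1).2
    have h2 : ‖e * a‖ ≤ ‖a‖ := (norm_mul_le _ _).trans
      (mul_le_of_le_one_left (norm_nonneg _) (norm_le_one_of_mem_idealContractions he))
    have h3 : f (e * a) - f (a * u) = f (e * a * (1 - u)) + f (e * (a * u) - a * u) := by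
      rw [← map_sub, ← map_add]; congr 1; noncomm_ring
    rw [h3]
    refine (abs_add_le _ _).trans_lt (add_lt_add_of_le_of_lt (h1.trans ?_) hue)
    gcongr
  obtain ⟨u, huK, huP⟩ := (hK.and hP).exists
  filter_upwards [hK, hP, hnear huK] with e heK heP heu
  -- Compare through a later `v`: `f (e * a) ≈ f (a * u) ≈ f (v * a) ≈ f (a * e)`.
  obtain ⟨v, hvK, hve, hvu⟩ := (hK.and ((hnear heK).and (hnear huK))).exists
  have h1 := abs_lt.1 (hclose huP heK heu)
  have h2 := abs_lt.1 (hclose heP hvK hve)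
  have h3 := abs_lt.1 (hclose huP hvK hvu)
  rw [sub_zero, map_sub, Real.norm_eq_abs, abs_lt]
  constructor <;> linarith [h1.1, h1.2, h2.1, h2.2, h3.1, h3.2]

/-- Mazur's argument: commutators tend weakly to zero, and convexity upgrades this to norm
smallness. Restricting to the convex set `D` keeps the approximate-unit estimates. -/
theorem exists_quasicentral_of_finset {J : Submodule ℂ B} (hJ : IsAlgebraIdeal J)
    (s : Finset B) (t : Finset J) {ε : ℝ} (hε : 0 < ε) :
    ∃ e ∈ idealContractions J, (∀ a ∈ s, ‖e * a - a * e‖ < ε) ∧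
      ∀ y ∈ t, ‖e * (y : B) - y‖ < ε := by
  classical
  obtain ⟨l, hne, hK, hl, hl'⟩ := exists_approximateUnit hJ
  set L : B →ₗ[ℝ] (s → B) := LinearMap.pi fun a =>
    LinearMap.mulRight ℝ (a : B) - LinearMap.mulLeft ℝ (a : B) with hL
  set D : Set B := idealContractions J ∩ ⋂ y ∈ t, {e | ‖e * (y : B) - y‖ < ε} with hD
  have hconv : Convex ℝ D := by
    refine (convex_idealContractions J).inter (convex_iInter₂ fun y _ => ?_)
    have : {e : B | ‖e * (y : B) - y‖ < ε}
        = LinearMap.mulRight ℝ (y : B) ⁻¹' Metric.ball (y : B) ε := by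
      ext e; simp [dist_eq_norm]
    rw [this]
    exact (convex_ball _ _).linear_preimage _
  by_contra! hcon
  have hdisj : Disjoint (Metric.ball (0 : s → B) ε) (L '' D) := by
    rw [Set.disjoint_left]
    rintro _ hball ⟨e, ⟨heK, het⟩, rfl⟩
    rw [mem_ball_zero_iff, pi_norm_lt_iff hε] at hball
    obtain ⟨y, hy, hye⟩ := hcon e heK fun a ha => by simpa [hL] using hball ⟨a, ha⟩
    exact absurd (by simpa using Set.mem_iInter₂.1 het y hy) (not_lt.2 hye)
  obtain ⟨f, u, hfu, hu⟩ := geometric_hahn_banach_open (convex_ball 0 ε) Metric.isOpen_ball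
    (hconv.linear_image L) hdisj
  have hu0 : 0 < u := by simpa using hfu 0 (Metric.mem_ball_self hε)
  have hlim : Tendsto (fun e => f (L e)) l (𝓝 0) := by
    have hsum : ∀ e, f (L e) = ∑ a : s,
        (f.comp (ContinuousLinearMap.single ℝ (fun _ : s => B) a)) (e * (a : B) - a * e) := by
      intro e
      rw [← Finset.univ_sum_single (L e), map_sum]
      rfl
    simp only [hsum]
    simpa using tendsto_finsetSum (Finset.univ : Finset s) fun a _ =>
      tendsto_apply_commutator hJ hK hl hl'
        (f.comp (ContinuousLinearMap.single ℝ (fun _ : s => B) a)) (a : B)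
  have hev : ∀ᶠ e in l, ∀ y ∈ t, ‖e * (y : B) - y‖ < ε :=
    (Filter.eventually_all_finset t).2 fun y _ =>
      tendsto_iff_eventually_norm_sub_lt.1 (hl' y y.2) ε hε
  obtain ⟨e, heK, het, hfe⟩ := (hK.and (hev.and (hlim.eventually_lt_const hu0))).exists
  exact absurd (hu _ ⟨e, ⟨heK, Set.mem_iInter₂.2 het⟩, rfl⟩) (not_le.2 hfe)

/-- Every ideal of a unital C⋆-algebra has an approximate unit which is quasicentral. -/
theorem exists_quasicentral_approximateUnit {J : Submodule ℂ B} (hJ : IsAlgebraIdeal J) :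
    ∃ l : Filter B, l.NeBot ∧ (∀ᶠ e in l, e ∈ idealContractions J) ∧
      (∀ y ∈ J, Tendsto (fun e => e * y) l (𝓝 y)) ∧
      ∀ a, Tendsto (fun e => e * a - a * e) l (𝓝 0) := by
  obtain ⟨l, hl, hK, h⟩ := exists_filter_of_finset (idealContractions J)
    (Sum.elim (fun (a : B) e => ‖e * a - a * e‖) fun (y : J) e => ‖e * (y : B) - y‖)
    fun t ε hε => by
      obtain ⟨e, heK, h1, h2⟩ := exists_quasicentral_of_finset hJ t.toLeft t.toRight hε
      refine ⟨e, heK, ?_⟩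
      rintro (a | y) hi
      · exact h1 a (Finset.mem_toLeft.2 hi)
      · exact h2 y (Finset.mem_toRight.2 hi)
  refine ⟨l, hl, hK, fun y hy => ?_, fun a => ?_⟩ <;>
    rw [tendsto_iff_eventually_norm_sub_lt] <;> intro ε hε
  · exact h (.inr ⟨y, hy⟩) ε hε
  · simpa using h (.inl a) ε hε

end Quasicentral

/-! ### Commutators under functional calculus, and the correction step. -/

theorem norm_pow_commutator_le {B : Type*} [NormedRing B] {e a : B} (he : ‖e‖ ≤ 1) (n : ℕ) :
    ‖e ^ n * a - a * e ^ n‖ ≤ n * ‖e * a - a * e‖ := by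
  induction n with
  | zero => simp
  | succ n ih =>
    have : e ^ (n + 1) * a - a * e ^ (n + 1)
        = e * (e ^ n * a - a * e ^ n) + (e * a - a * e) * e ^ n := by
      rw [pow_succ']; noncomm_ring
    rw [this]
    have h1 : ‖e * (e ^ n * a - a * e ^ n)‖ ≤ ‖e ^ n * a - a * e ^ n‖ :=
      (norm_mul_le _ _).trans (mul_le_of_le_one_left (norm_nonneg _) he)
    have h2 : ‖(e * a - a * e) * e ^ n‖ ≤ ‖e * a - a * e‖ := by
      rcases n.eq_zero_or_pos with rfl | hn
      · simp
      · exact (norm_mul_le _ _).trans (mul_le_of_le_one_right (norm_nonneg _)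
          ((norm_pow_le' e hn).trans (pow_le_one₀ (norm_nonneg _) he)))
    push_cast
    linarith [norm_add_le (e * (e ^ n * a - a * e ^ n)) ((e * a - a * e) * e ^ n)]

theorem tendsto_aeval_commutator {B : Type*} [NormedRing B] [NormedAlgebra ℝ B]
    {l : Filter B} (hl : ∀ᶠ e in l, ‖e‖ ≤ 1) {a : B}
    (ha : Tendsto (fun e => e * a - a * e) l (𝓝 0)) (p : Polynomial ℝ) :
    Tendsto (fun e => Polynomial.aeval e p * a - a * Polynomial.aeval e p) l (𝓝 0) := by
  induction p using Polynomial.induction_on' with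
  | add p q hp hq =>
    have := hp.add hq
    rw [add_zero] at this
    refine this.congr fun e => ?_
    rw [map_add]; noncomm_ring
  | monomial n c =>
    have h1 : Tendsto (fun e => e ^ n * a - a * e ^ n) l (𝓝 0) := by
      refine squeeze_zero_norm' (hl.mono fun e he => norm_pow_commutator_le he n) ?_
      simpa using ha.norm.const_mul (n : ℝ)
    have h2 := h1.const_smul c
    rw [smul_zero] at h2
    refine h2.congr fun e => ?_
    rw [Polynomial.aeval_monomial, ← Algebra.smul_def, smul_mul_assoc, mul_smul_comm, smul_sub]

section Core

variable {B : Type*} [CStarAlgebra B] [PartialOrder B] [StarOrderedRing B]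

theorem spectrum_subset_Icc_of_contraction {e : B} (he0 : 0 ≤ e) (he1 : e ≤ 1) :
    spectrum ℝ e ⊆ Set.Icc 0 1 := fun x hx =>
  ⟨spectrum_nonneg_of_nonneg he0 hx, (le_abs_self x).trans
    ((IsometricContinuousFunctionalCalculus.norm_spectrum_le e hx (IsSelfAdjoint.of_nonneg he0)).trans
      ((CStarAlgebra.norm_le_one_iff_of_nonneg e he0).2 he1))⟩

theorem tendsto_cfc_commutator {l : Filter B} (hl : ∀ᶠ e in l, 0 ≤ e ∧ e ≤ 1) {a : B}
    (ha : Tendsto (fun e => e * a - a * e) l (𝓝 0)) {f : ℝ → ℝ}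
    (hf : ContinuousOn f (Set.Icc 0 1)) :
    Tendsto (fun e => cfc f e * a - a * cfc f e) l (𝓝 0) := by
  rw [tendsto_iff_eventually_norm_sub_lt]
  intro ε hε
  set η := ε / (4 * (‖a‖ + 1)) with hη
  have hη0 : 0 < η := by positivity
  have hηε : 4 * (η * ‖a‖ + η) = ε := by rw [hη]; field_simp
  obtain ⟨p, hp⟩ := exists_polynomial_near_of_continuousOn 0 1 f hf η hη0
  have hnorm : ∀ᶠ e in l, ‖e‖ ≤ 1 :=
    hl.mono fun e he => (CStarAlgebra.norm_le_one_iff_of_nonneg e he.1).2 he.2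
  filter_upwards [hl, tendsto_iff_eventually_norm_sub_lt.1 (tendsto_aeval_commutator hnorm ha p)
    (ε / 2) (by positivity)] with e he hpe
  have hsa : IsSelfAdjoint e := .of_nonneg he.1
  have hsp := spectrum_subset_Icc_of_contraction he.1 he.2
  have hdiff : ‖cfc f e - Polynomial.aeval e p‖ ≤ η := by
    rw [← cfc_polynomial p e hsa, ← cfc_sub f p.eval e (hf.mono hsp) p.continuous.continuousOn]
    refine norm_cfc_le hη0.le fun x hx => ?_
    rw [Real.norm_eq_abs, abs_sub_comm]
    exact (hp x (hsp hx)).le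
  rw [sub_zero] at hpe ⊢
  have : cfc f e * a - a * cfc f e = (cfc f e - Polynomial.aeval e p) * a
      - a * (cfc f e - Polynomial.aeval e p)
      + (Polynomial.aeval e p * a - a * Polynomial.aeval e p) := by noncomm_ring
  rw [this]
  have h1 : ‖(cfc f e - Polynomial.aeval e p) * a‖ ≤ η * ‖a‖ :=
    (norm_mul_le _ _).trans (by gcongr)
  have h2 : ‖a * (cfc f e - Polynomial.aeval e p)‖ ≤ η * ‖a‖ :=
    (norm_mul_le _ _).trans (by rw [mul_comm]; gcongr)
  refine (norm_add_le _ _).trans_lt ?_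
  refine (add_lt_add_of_le_of_lt (norm_sub_le _ _) hpe).trans_le ?_
  linarith

/-- A contraction `e` has a complementary pair of square roots of `e` and `1 - e`. -/
theorem cfc_sqrt_pair {e : B} (he0 : 0 ≤ e) (he1 : e ≤ 1) :
    cfc Real.sqrt e * cfc Real.sqrt e = e ∧
    cfc (fun x => Real.sqrt (1 - x)) e * cfc (fun x => Real.sqrt (1 - x)) e = 1 - e ∧
    ‖cfc Real.sqrt e‖ ≤ 1 ∧ ‖cfc (fun x => Real.sqrt (1 - x)) e‖ ≤ 1 := by
  have hsa : IsSelfAdjoint e := .of_nonneg he0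
  have hsp := spectrum_subset_Icc_of_contraction he0 he1
  refine ⟨?_, ?_, ?_, ?_⟩
  · rw [← cfc_mul Real.sqrt Real.sqrt e]
    conv_rhs => rw [← cfc_id' ℝ e hsa]
    exact cfc_congr fun x hx => Real.mul_self_sqrt (hsp hx).1
  · rw [← cfc_mul _ _ e]
    have h1 : cfc (fun x : ℝ => 1 - x) e = 1 - e := by
      rw [cfc_sub (fun _ => (1 : ℝ)) (fun x => x) e, cfc_const_one ℝ e hsa, cfc_id' ℝ e hsa]
    rw [← h1]
    exact cfc_congr fun x hx => Real.mul_self_sqrt (sub_nonneg.2 (hsp hx).2)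
  · refine norm_cfc_le zero_le_one fun x hx => ?_
    rw [Real.norm_of_nonneg (Real.sqrt_nonneg _), Real.sqrt_le_one]
    exact (hsp hx).2
  · refine norm_cfc_le zero_le_one fun x hx => ?_
    rw [Real.norm_of_nonneg (Real.sqrt_nonneg _), Real.sqrt_le_one]
    linarith [(hsp hx).1]

theorem exists_mem_norm_sub_le_half {E F : Submodule ℂ B} {l : Filter B} [l.NeBot]
    (hl : ∀ᶠ e in l, 0 ≤ e ∧ e ≤ 1)
    (hcomm : ∀ a, Tendsto (fun e => e * a - a * e) l (𝓝 0))
    (hE : ∀ w ∈ E, ∀ ε > 0, ∀ᶠ e in l, ∃ z ∈ F, ‖e * w - z‖ < ε)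
    (hF : ∀ y ∈ F, Tendsto (fun e => e * y) l (𝓝 y))
    {w : B} (hw : w ∈ E) {d ε : ℝ} (hd : 0 ≤ d) (hε : 0 < ε) (hwd : ‖w‖ ≤ d + ε)
    (hdist : ∀ δ > 0, ∃ y ∈ F, ‖w - y‖ < d + δ) :
    ∃ y ∈ F, ‖y‖ ≤ 2 * ε ∧ ‖w - y‖ ≤ d + ε / 2 := by
  obtain ⟨y₀, hy₀, hwy⟩ := hdist (ε / 8) (by positivity)
  have hε' : 0 < ε / 32 := by positivity
  have hs := fun a => tendsto_iff_eventually_norm_sub_lt.1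
    (tendsto_cfc_commutator hl (hcomm a) Real.continuous_sqrt.continuousOn) _ hε'
  have hr := fun a => tendsto_iff_eventually_norm_sub_lt.1
    (tendsto_cfc_commutator hl (hcomm a) (f := fun x => Real.sqrt (1 - x)) (by fun_prop)) _ hε'
  obtain ⟨e, ⟨he0, he1⟩, ⟨z, hzF, hz⟩, hsw, hrw, hry, hey⟩ := (hl.and
    ((hE w hw _ hε').and ((hs w).and ((hr w).and ((hr y₀).and
      (tendsto_iff_eventually_norm_sub_lt.1 (hF y₀ hy₀) _ hε')))))).exists
  obtain ⟨hss, hrr, hs1, hr1⟩ := cfc_sqrt_pair he0 he1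
  have hsr : Commute (cfc Real.sqrt e) (cfc (fun x => Real.sqrt (1 - x)) e) :=
    cfc_commute_cfc _ _ _
  have hsa : IsSelfAdjoint (cfc Real.sqrt e) := cfc_predicate _ _
  have hra : IsSelfAdjoint (cfc (fun x => Real.sqrt (1 - x)) e) := cfc_predicate _ _
  generalize cfc Real.sqrt e = s at *
  generalize cfc (fun x => Real.sqrt (1 - x)) e = r at *
  simp only [sub_zero] at hsw hrw hry
  have hdε : 0 < d + ε := by positivity
  -- Chosen so that `(1 - t) * (d + ε) = d`, while `t • (e * w)` has norm at most `ε`.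
  set t := ε / (d + ε) with ht
  have ht0 : 0 ≤ t := by positivity
  have ht1 : t ≤ 1 := (div_le_one hdε).2 (by linarith)
  have htε : t * (d + ε) = ε := div_mul_cancel₀ _ hdε.ne'
  have hX : ‖s * ((1 - t) • w) * s + r * (w - y₀) * r‖ ≤ d + ε / 8 := by
    refine norm_conjugate_add_conjugate_le hsa hra hsr (by rw [hss, hrr]; abel) (by positivity)
      ?_ hwy.le
    rw [norm_smul, Real.norm_of_nonneg (by linarith)]
    nlinarith [mul_le_mul_of_nonneg_left hwd (sub_nonneg.2 ht1)]
  -- The main term costs `d + ε / 8`; the five errors cost at most `ε / 32` each.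
  have hdecomp : w - t • z = (s * ((1 - t) • w) * s + r * (w - y₀) * r)
      + (t • (e * w - z) + (1 - t) • (s * (s * w - w * s)) + r * (r * w - w * r)
        - r * (r * y₀ - y₀ * r) - (e * y₀ - y₀)) := by
    have h1 : s * (s * w - w * s) = e * w - s * w * s := by
      rw [mul_sub, ← mul_assoc, hss, mul_assoc s w]
    have h2 : ∀ v, r * (r * v - v * r) = (1 - e) * v - r * v * r := fun v => by
      rw [mul_sub, ← mul_assoc, hrr, mul_assoc r v]
    rw [h1, h2, h2, mul_smul_comm, smul_mul_assoc]
    simp only [mul_sub, sub_mul, one_mul, smul_sub, sub_smul, one_smul]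
    abel
  have hb1 : ‖t • (e * w - z)‖ ≤ ε / 32 := by
    rw [norm_smul, Real.norm_of_nonneg ht0]
    exact (mul_le_of_le_one_left (norm_nonneg _) ht1).trans hz.le
  have hb2 : ‖(1 - t) • (s * (s * w - w * s))‖ ≤ ε / 32 := by
    rw [norm_smul, Real.norm_of_nonneg (by linarith)]
    refine (mul_le_of_le_one_left (norm_nonneg _) (by linarith)).trans ?_
    exact (norm_mul_le _ _).trans ((mul_le_of_le_one_left (norm_nonneg _) hs1).trans hsw.le)
  have hb3 : ‖r * (r * w - w * r)‖ ≤ ε / 32 :=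
    (norm_mul_le _ _).trans ((mul_le_of_le_one_left (norm_nonneg _) hr1).trans hrw.le)
  have hb4 : ‖r * (r * y₀ - y₀ * r)‖ ≤ ε / 32 :=
    (norm_mul_le _ _).trans ((mul_le_of_le_one_left (norm_nonneg _) hr1).trans hry.le)
  refine ⟨t • z, F.smul_of_tower_mem t hzF, ?_, ?_⟩
  · have he : ‖e‖ ≤ 1 := (CStarAlgebra.norm_le_one_iff_of_nonneg e he0).2 he1
    have h1 : ‖e * w‖ ≤ d + ε :=
      ((norm_mul_le _ _).trans (mul_le_of_le_one_left (norm_nonneg _) he)).trans hwd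
    have h2 : t • z = t • (e * w) - t • (e * w - z) := by rw [smul_sub]; abel
    rw [h2]
    refine (norm_sub_le _ _).trans ?_
    have h3 : ‖t • (e * w)‖ ≤ ε := by
      rw [norm_smul, Real.norm_of_nonneg ht0, ← htε]
      gcongr
    linarith
  · rw [hdecomp]
    refine (norm_add_le _ _).trans ?_
    have := norm_sub_le (t • (e * w - z) + (1 - t) • (s * (s * w - w * s)) + r * (r * w - w * r)
        - r * (r * y₀ - y₀ * r)) (e * y₀ - y₀)
    have := norm_sub_le (t • (e * w - z) + (1 - t) • (s * (s * w - w * s)) + r * (r * w - w * r))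
      (r * (r * y₀ - y₀ * r))
    have := norm_add_le (t • (e * w - z) + (1 - t) • (s * (s * w - w * s))) (r * (r * w - w * r))
    have := norm_add_le (t • (e * w - z)) ((1 - t) • (s * (s * w - w * s)))
    linarith

/-- Successive approximation: if near-minimizers can be improved by controlled corrections,
then the distance to a closed subspace is attained. -/
theorem exists_norm_sub_eq_infDist {X : Type*} [NormedAddCommGroup X] [NormedSpace ℂ X]
    [CompleteSpace X] {E F : Submodule ℂ X} (hFE : F ≤ E) (hFc : IsClosed (F : Set X))
    (h : ∀ w ∈ E, ∀ d ε : ℝ, 0 ≤ d → 0 < ε → ‖w‖ ≤ d + ε →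
      (∀ δ > 0, ∃ y ∈ F, ‖w - y‖ < d + δ) → ∃ y ∈ F, ‖y‖ ≤ 2 * ε ∧ ‖w - y‖ ≤ d + ε / 2)
    {x : X} (hx : x ∈ E) : ∃ y ∈ F, ‖x - y‖ = Metric.infDist x (F : Set X) := by
  set d := Metric.infDist x (F : Set X) with hd
  have hd0 : 0 ≤ d := Metric.infDist_nonneg
  -- Lets the iteration start at `0`, with positive excess bound.
  set C := ‖x‖ + 1 with hC
  have hC0 : 0 < C := by positivity
  have hstep : ∀ (n : ℕ) (y : X), y ∈ F ∧ ‖x - y‖ ≤ d + C * (1 / 2) ^ n →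
      ∃ y' : X, ‖y' - y‖ ≤ 2 * C * (1 / 2) ^ n ∧
        y' ∈ F ∧ ‖x - y'‖ ≤ d + C * (1 / 2) ^ (n + 1) := by
    rintro n y ⟨hyF, hy⟩
    obtain ⟨v, hv, hv1, hv2⟩ := h (x - y) (E.sub_mem hx (hFE hyF)) d _ hd0
      (by positivity : 0 < C * (1 / 2) ^ n) hy fun δ hδ => by
        obtain ⟨u, hu, hxu⟩ := (Metric.infDist_lt_iff ⟨0, F.zero_mem⟩).1
          (show Metric.infDist x (F : Set X) < d + δ by linarith)
        refine ⟨u - y, F.sub_mem hu hyF, ?_⟩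
        rwa [sub_sub_sub_cancel_right, ← dist_eq_norm]
    refine ⟨y + v, ?_, F.add_mem hyF hv, ?_⟩
    · simpa [mul_assoc] using hv1
    · rw [← sub_sub]
      refine hv2.trans (le_of_eq ?_)
      ring
  choose! g hg1 hg2 using hstep
  let Y : ℕ → X := fun n => Nat.rec 0 g n
  have hY : ∀ n, Y n ∈ F ∧ ‖x - Y n‖ ≤ d + C * (1 / 2) ^ n := by
    intro n
    induction n with
    | zero =>
      refine ⟨F.zero_mem, ?_⟩
      have : Y 0 = 0 := rfl
      rw [this]
      simp only [sub_zero, pow_zero, mul_one]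
      linarith
    | succ n ih => exact hg2 n (Y n) ih
  have hcau : CauchySeq Y :=
    cauchySeq_of_le_geometric (1 / 2) (2 * C) (by norm_num) fun n => by
      rw [dist_comm, dist_eq_norm]
      exact hg1 n (Y n) (hY n)
  obtain ⟨y, hy⟩ := cauchySeq_tendsto_of_complete hcau
  have hyF : y ∈ F := hFc.mem_of_tendsto hy (.of_forall fun n => (hY n).1)
  refine ⟨y, hyF, le_antisymm ?_ ?_⟩
  · have hlim : Tendsto (fun n : ℕ => d + C * (1 / 2 : ℝ) ^ n) atTop (𝓝 d) := by
      simpa using ((tendsto_pow_atTop_nhds_zero_of_lt_one (r := (1 / 2 : ℝ)) (by norm_num)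
        (by norm_num)).const_mul C).const_add d
    exact le_of_tendsto_of_tendsto' (hy.const_sub x).norm hlim fun n => (hY n).2
  · rw [← dist_eq_norm]
    exact Metric.infDist_le_dist_of_mem hyF

end Core

/-! ### Unitization, elementary operators and the quotient norm. -/

theorem isAlgebraIdeal_map_inr {A : Type*} [NonUnitalCStarAlgebra A] {I : Submodule ℂ A}
    (hI : IsAlgebraIdeal I) : IsAlgebraIdeal (I.map (Unitization.inrHom ℂ ℂ A)) := by
  rintro a _ ⟨x, hx, rfl⟩
  induction a using Unitization.ind with
  | inl_add_inr r a =>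
    constructor
    · refine ⟨r • x + a * x, I.add_mem (I.smul_mem r hx) (hI a x hx).1, ?_⟩
      simp [add_mul, Unitization.inl_mul_inr]
    · refine ⟨r • x + x * a, I.add_mem (I.smul_mem r hx) (hI a x hx).2, ?_⟩
      simp [mul_add, Unitization.inr_mul_inl]

theorem tendsto_mul_left_of_mem_closure {B : Type*} [NormedRing B] {l : Filter B}
    (hl : ∀ᶠ e in l, ‖e‖ ≤ 1) {S : Set B} (hS : ∀ y ∈ S, Tendsto (fun e => e * y) l (𝓝 y))
    {y : B} (hy : y ∈ closure S) : Tendsto (fun e => e * y) l (𝓝 y) := by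
  rw [tendsto_iff_eventually_norm_sub_lt]
  intro ε hε
  obtain ⟨z, hz, hyz⟩ := Metric.mem_closure_iff.1 hy (ε / 3) (by positivity)
  rw [dist_eq_norm] at hyz
  filter_upwards [hl, tendsto_iff_eventually_norm_sub_lt.1 (hS z hz) (ε / 3) (by positivity)]
    with e he hez
  have h1 : e * y - y = e * (y - z) + (e * z - z) - (y - z) := by noncomm_ring
  have h2 : ‖e * (y - z)‖ ≤ ‖y - z‖ :=
    (norm_mul_le _ _).trans (mul_le_of_le_one_left (norm_nonneg _) he)
  rw [h1]
  linarith [norm_sub_le (e * (y - z) + (e * z - z)) (y - z),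
    norm_add_le (e * (y - z)) (e * z - z)]

theorem exists_norm_sub_eq_infDist_of_isElementaryOperator {A : Type*} [NonUnitalCStarAlgebra A]
    {T : A →ₗ[ℂ] A} (hT : IsElementaryOperator T) {I : Submodule ℂ A} (hI : IsAlgebraIdeal I)
    {x : A} (hx : x ∈ (LinearMap.range T).topologicalClosure) :
    ∃ y ∈ (I.map T).topologicalClosure,
      ‖x - y‖ = Metric.infDist x ((I.map T).topologicalClosure : Set A) := by
  let _ : PartialOrder (Unitization ℂ A) := CStarAlgebra.spectralOrder _
  let _ : StarOrderedRing (Unitization ℂ A) := CStarAlgebra.spectralOrderedRing _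
  obtain ⟨N, a, b, hab⟩ := hT
  obtain ⟨l, hl, hK, hJ, hcomm⟩ :=
    exists_quasicentral_approximateUnit (isAlgebraIdeal_map_inr hI)
  have hnorm : ∀ᶠ e in l, ‖e‖ ≤ 1 := hK.mono fun e he => norm_le_one_of_mem_idealContractions he
  have hiso : Isometry (Unitization.inrHom ℂ ℂ A) :=
    AddMonoidHomClass.isometry_of_norm _ fun x => Unitization.norm_inr x
  -- Hence the approximate unit of `I` also acts as one on the closure of `T(I)`.
  have hTI : ∀ y ∈ I.map T, y ∈ I := by
    rintro _ ⟨x, hx, rfl⟩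
    rw [hab]
    exact I.sum_mem fun i _ => (hI _ _ (hI _ _ hx).1).2
  refine exists_norm_sub_eq_infDist (E := (LinearMap.range T).topologicalClosure)
    (Submodule.topologicalClosure_mono (LinearMap.map_le_range))
    (Submodule.isClosed_topologicalClosure _) ?_ hx
  intro w hw d ε hd hε hwd hdist
  suffices hex : ∃ y ∈ (I.map T).topologicalClosure.map (Unitization.inrHom ℂ ℂ A),
      ‖y‖ ≤ 2 * ε ∧ ‖Unitization.inrHom ℂ ℂ A w - y‖ ≤ d + ε / 2 by
    obtain ⟨_, ⟨y, hy, rfl⟩, h1, h2⟩ := hex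
    refine ⟨y, hy, (Unitization.norm_inr (𝕜 := ℂ) y).symm.trans_le h1, ?_⟩
    rwa [← map_sub, Unitization.inrHom_apply, Unitization.norm_inr] at h2
  refine exists_mem_norm_sub_le_half
    (E := (LinearMap.range T).topologicalClosure.map (Unitization.inrHom ℂ ℂ A))
    (hK.mono fun e he => he.2) hcomm ?_ ?_ ⟨w, hw, rfl⟩ hd hε
    ((Unitization.norm_inr w).trans_le hwd) ?_
  · rintro _ ⟨w, hw, rfl⟩ ε hε
    obtain ⟨_, ⟨x, rfl⟩, hwx⟩ := Metric.mem_closure_iff.1 hw (ε / 2) (by positivity)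
    rw [dist_eq_norm] at hwx
    have hlim : Tendsto (fun e : Unitization ℂ A => ∑ i, (e * (a i : Unitization ℂ A) - a i * e)
        * (x * b i : A)) l (𝓝 0) := by
      simpa using tendsto_finsetSum (Finset.univ : Finset (Fin N)) fun i _ =>
        (hcomm (a i)).mul_const ((x * b i : A) : Unitization ℂ A)
    filter_upwards [hK, tendsto_iff_eventually_norm_sub_lt.1 hlim (ε / 2) (by positivity)]
      with e heK he
    have he1 := norm_le_one_of_mem_idealContractions heK
    obtain ⟨u, hu, rfl⟩ := heK.1
    -- Although `e * T x` need not lie in `T(I)`, `T (u * x)` does, and the two differ by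
    -- commutators with the left coefficients only.
    refine ⟨_, ⟨T (u * x), Submodule.le_topologicalClosure _ ⟨_, (hI x u hu).2, rfl⟩, rfl⟩, ?_⟩
    simp only [Unitization.inrHom_apply, sub_zero] at he he1 ⊢
    have hsum : ∑ i, ((u : Unitization ℂ A) * (a i : Unitization ℂ A) - a i * u) * (x * b i : A)
        = ((u * T x - T (u * x) : A) : Unitization ℂ A) := by
      rw [hab, hab, Finset.mul_sum, ← Finset.sum_sub_distrib]
      refine Eq.trans (Finset.sum_congr rfl fun i _ => ?_)
        (map_sum (Unitization.inrHom ℂ ℂ A) _ _).symm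
      rw [Unitization.inrHom_apply, ← Unitization.inr_mul, ← Unitization.inr_mul,
        ← Unitization.inr_sub, ← Unitization.inr_mul]
      congr 1
      noncomm_ring
    rw [hsum, Unitization.norm_inr] at he
    rw [Unitization.norm_inr] at he1
    rw [← Unitization.inr_mul, ← Unitization.inr_sub, Unitization.norm_inr]
    have h1 : u * w - T (u * x) = u * (w - T x) + (u * T x - T (u * x)) := by
      rw [mul_sub]; abel
    have h2 : ‖u * (w - T x)‖ ≤ ‖w - T x‖ :=
      (norm_mul_le _ _).trans (mul_le_of_le_one_left (norm_nonneg _) he1)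
    rw [h1]
    linarith [norm_add_le (u * (w - T x)) (u * T x - T (u * x))]
  · rintro _ ⟨y, hy, rfl⟩
    refine tendsto_mul_left_of_mem_closure hnorm (S := Unitization.inrHom ℂ ℂ A '' I) hJ ?_
    exact image_closure_subset_closure_image hiso.continuous
      ⟨y, closure_mono hTI hy, rfl⟩
  · intro δ hδ
    obtain ⟨y, hy, hwy⟩ := hdist δ hδ
    refine ⟨_, ⟨y, hy, rfl⟩, ?_⟩
    rwa [← map_sub, Unitization.inrHom_apply, Unitization.norm_inr]

theorem isProximinal_submoduleOf {X : Type*} [NormedAddCommGroup X] [NormedSpace ℂ X]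
    {E F : Submodule ℂ X} (hFE : F ≤ E)
    (h : ∀ x ∈ E, ∃ y ∈ F, ‖x - y‖ = Metric.infDist x (F : Set X)) :
    IsProximinal (F.submoduleOf E) := by
  intro x
  obtain ⟨y, hy, hxy⟩ := h x x.2
  refine ⟨⟨y, hFE hy⟩, hy, ?_⟩
  have himg : E.subtype '' (F.submoduleOf E : Set E) = (F : Set X) := by
    ext z
    exact ⟨by rintro ⟨u, hu, rfl⟩; exact hu, fun hz => ⟨⟨z, hFE hz⟩, hz, rfl⟩⟩
  have hiso : Isometry E.subtype := isometry_subtype_coe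
  rw [← Metric.infDist_image hiso, himg]
  exact hxy

theorem IsProximinal.exists_norm_eq {X : Type*} [NormedAddCommGroup X] [NormedSpace ℂ X]
    {Y : Submodule ℂ X} (hY : IsProximinal Y) (z : X ⧸ Y) :
    ∃ x : X, Submodule.Quotient.mk x = z ∧ ‖x‖ = ‖z‖ := by
  obtain ⟨x, rfl⟩ := Submodule.Quotient.mk_surjective _ z
  obtain ⟨y, hy, hxy⟩ := hY x
  refine ⟨x - y, ?_, hxy.trans (QuotientAddGroup.norm_mk (S := Y.toAddSubgroup) x).symm⟩
  rw [Submodule.Quotient.eq]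
  simpa using hy

theorem mainTheorem3 {A : Type*} [NonUnitalCStarAlgebra A]
    (T : A →ₗ[ℂ] A) (hT : IsElementaryOperator T)
    (I : Submodule ℂ A) (hI : IsAlgebraIdeal I) :
    (I.map T).topologicalClosure ≤ (LinearMap.range T).topologicalClosure ∧
    IsProximinal
      ((I.map T).topologicalClosure.submoduleOf (LinearMap.range T).topologicalClosure) ∧
    ∀ z : ↥(LinearMap.range T).topologicalClosure ⧸
        (I.map T).topologicalClosure.submoduleOf (LinearMap.range T).topologicalClosure,
      ∃ x : ↥(LinearMap.range T).topologicalClosure,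
        Submodule.Quotient.mk x = z ∧ ‖x‖ = ‖z‖ := by
  have hle : (I.map T).topologicalClosure ≤ (LinearMap.range T).topologicalClosure :=
    Submodule.topologicalClosure_mono LinearMap.map_le_range
  have hprox := isProximinal_submoduleOf hle fun x hx =>
    exists_norm_sub_eq_infDist_of_isElementaryOperator hT hI hx
  exact ⟨hle, hprox, hprox.exists_norm_eq⟩
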